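/- Let $G$ be a finite directed multigraph (self-loops and multiple edges allowed) with a global sink $s$, i.e. a vertex without outgoing edges to which there is a directed path from every vertex, and fix for each vertex $v$ a cyclic ordering $e\mapsto e^+$ of the edges with tail $v$. Let $V'$ be the set of vertices other than $s$. Let $\Delta'$ be the matrix obtained from the Laplacian $\Delta=D-A$ by deleting the row and column of $s$, where $D$ is the diagonal matrix of out-degrees and $A_{vw}$ is the number of edges from $v$ to $w$. The sandpile group is $\mathcal S(G)=\mathbb Z^{V'}/\mathbb Z^{V'}\Delta'$, the quotient by the integer row span of $\Delta'$. A chip configuration is a vector $\sigma\in\mathbb Z_{\ge 0}^{V'}$; $[\sigma]$ is its class in $\mathcal S(G)$, and $\mathbf 1_v$ is the configuration with a single chip at $v$. A rotor configuration $\rho$ assigns to each $v\in V'$ an edge $\rho(v)$ with tail $v$; it is acyclic if the edges $\rho(v)$ contain no directed cycle. Acyclic rotor configurations are identified with the oriented spanning trees of $G$ rooted at $s$ (acyclic sets of edges that contain exactly one edge with tail $v$ for each $v\in V'$) by $\rho\mapsto\{\rho(v):v\in V'\}$. A chip at $v\in V'$ is routed for one step by replacing $\rho(v)$ with $\rho(v)^+$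 and moving the chip to the head of $\rho(v)^+$; chips that arrive at $s$ disappear. For $v\in V'$ the chip addition operator $E_v$ sends $\rho$ to the rotor configuration obtained by adding one chip at $v$ and routing it until it reaches $s$. For a chip configuration $\sigma$, let $\sigma(\rho)$ be the rotor configuration obtained by adding $\sigma(v)$ chips at each $v\in V'$ and routing them one step at a time, in any order, until all have reached $s$. The rotor-router group of $G$ is the subgroup, generated by the operators $E_v$ ($v\in V'$), of the group of permutations of the oriented spanning trees of $G$ rooted at $s$. Then: 1. A single chip started anywhere with any rotor configuration reaches $s$ after finitely many steps, so that $E_v$ is well defined; for every chip configuration $\sigma$ and rotor configuration $\rho$, all the chips can be routed to $s$ and $\sigma(\rho)$ does not depend on the order of the routings. 2. Each $E_v$ restricts to a bijection of the set of acyclic rotor configurations onto itself, and $G$ has at least one oriented spanning tree rooted at $s$. 3. The rotor-router group is isomorphic to $\mathcal S(G)$. More precisely, there is a group isomorphism $\Phi$ from $\mathcal S(G)$ onto the rotor-router group such that $\Phi([\mathbf 1_v])=E_v$ for all $v\in V'$, and $\Phi([\sigma])\rho=\sigma(\rho)$ for every chip configuration $\sigma$ and acyclic rotor configuration $\rho$.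 In particular $\sigma(\rho)$ depends only on $[\sigma]$ and $\rho$. 4. The resulting action of $\mathcal S(G)$ on the oriented spanning trees is transitive (for any two trees $\rho,\rho'$ there is a chip configuration $\sigma$ with $\sigma(\rho)=\rho'$) and free (if $g\in\mathcal S(G)$ and $\Phi(g)\rho=\rho$ for some tree $\rho$, then $g$ is the identity). -/

import Mathlib

/-- A directed multigraph: self-loops and multiple edges are allowed. -/
structure MultiDigraph (V : Type*) (E : Type*) where
  tail : E → V
  head : E → V

namespace MultiDigraph

variable {V : Type*} {E : Type*} (G : MultiDigraph V E)

/-- A vertex without outgoing edges. -/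
def IsSink (v : V) : Prop := ∀ e : E, G.tail e ≠ v

/-- There is an edge of the set `T` from `a` to `b`. -/
def AdjIn (T : Set E) (a b : V) : Prop := ∃ e ∈ T, G.tail e = a ∧ G.head e = b

/-- A sink to which there is a directed path from every vertex. -/
def IsGlobalSink (s : V) : Prop :=
  G.IsSink s ∧ ∀ v : V, Relation.ReflTransGen (G.AdjIn Set.univ) v s

/-- The set of edges `T` contains no directed cycle (a self-loop is a directed cycle). -/
def IsAcyclicEdgeSet (T : Set E) : Prop := ∀ v : V, ¬ Relation.TransGen (G.AdjIn T) v v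

/-- The non-sink vertices. -/
abbrev NonSink : Type _ := {v : V // ¬ G.IsSink v}

/-- Number of edges with tail `v`. -/
noncomputable def outdeg (v : V) : ℕ := Nat.card {e : E // G.tail e = v}

/-- Number of edges from `v` to `w`. -/
noncomputable def edgeCount (v w : V) : ℕ := Nat.card {e : E // G.tail e = v ∧ G.head e = w}

open Classical in
/-- The graph Laplacian `D - A`. -/
noncomputable def laplacian : Matrix V V ℤ :=
  Matrix.diagonal (fun v => (G.outdeg v : ℤ)) - Matrix.of (fun v w => (G.edgeCount v w : ℤ))

/-- The Laplacian with the rows and columns of sinks deleted; if there is a global sink, it is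
the only sink. -/
noncomputable def reducedLaplacian : Matrix G.NonSink G.NonSink ℤ :=
  G.laplacian.submatrix Subtype.val Subtype.val

/-- The sandpile group: integer vectors modulo the integer row span of the reduced Laplacian. -/
abbrev SandpileGroup : Type _ :=
  (G.NonSink → ℤ) ⧸ AddSubgroup.closure (Set.range fun v => G.reducedLaplacian v)

/-- A number of chips on each non-sink vertex. -/
abbrev ChipConfig : Type _ := G.NonSink → ℕ

/-- The class of a chip configuration in the sandpile group. -/
noncomputable def chipClass (σ : G.ChipConfig) : G.SandpileGroup :=
  QuotientAddGroup.mk (fun v => (σ v : ℤ))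

open Classical in
/-- A single chip at `v`. -/
noncomputable def singleChip (v : G.NonSink) : G.ChipConfig := Pi.single v 1

/-- An outgoing edge for each non-sink vertex. -/
abbrev RotorConfig : Type _ := (v : G.NonSink) → {e : E // G.tail e = v}

/-- The set of edges used by a rotor configuration. -/
def rotorEdges (ρ : G.RotorConfig) : Set E := Set.range fun v => (ρ v : E)

/-- The rotors form no directed cycle. -/
def IsAcyclicRotor (ρ : G.RotorConfig) : Prop := G.IsAcyclicEdgeSet (G.rotorEdges ρ)

/-- The edge set of an acyclic subgraph in which every non-sink vertex has out-degree one. -/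
def IsOrientedSpanningTree (T : Set E) : Prop :=
  (∀ v : G.NonSink, ∃! e, e ∈ T ∧ G.tail e = v) ∧ G.IsAcyclicEdgeSet T

/-- Oriented spanning trees, as edge sets; if there is a global sink, it is the root. -/
abbrev OrientedSpanningTree : Type _ := {T : Set E // G.IsOrientedSpanningTree T}

theorem mem_rotorEdges_iff (ρ : G.RotorConfig) (v : G.NonSink) (e : E) :
    (e ∈ G.rotorEdges ρ ∧ G.tail e = v) ↔ e = ρ v := by
  constructor
  · rintro ⟨⟨w, rfl⟩, h⟩
    have hw : w = v := Subtype.ext ((ρ w).2.symm.trans h)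
    subst hw
    rfl
  · rintro rfl
    exact ⟨⟨v, rfl⟩, (ρ v).2⟩

/-- The identification of acyclic rotor configurations with oriented spanning trees:
a rotor configuration is sent to the set of its edges. -/
noncomputable def treeEquiv : {ρ : G.RotorConfig // G.IsAcyclicRotor ρ} ≃ G.OrientedSpanningTree :=
  Equiv.ofBijective
    (fun ρ => ⟨G.rotorEdges ρ.1,
      fun v => ⟨ρ.1 v, (G.mem_rotorEdges_iff ρ.1 v _).2 rfl,
        fun e he => (G.mem_rotorEdges_iff ρ.1 v e).1 he⟩, ρ.2⟩)
    (by
      constructor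
      · intro ρ ρ' h
        have h' : G.rotorEdges ρ.1 = G.rotorEdges ρ'.1 := congrArg Subtype.val h
        refine Subtype.ext (funext fun v => Subtype.ext ?_)
        rw [← G.mem_rotorEdges_iff ρ'.1 v, ← h']
        exact (G.mem_rotorEdges_iff ρ.1 v _).2 rfl
      · rintro ⟨T, hT, hac⟩
        have hT' := hT
        choose f hf huniq using hT'
        have hE : G.rotorEdges (fun v => ⟨f v, (hf v).2⟩) = T := by
          ext e
          constructor
          · rintro ⟨v, rfl⟩
            exact (hf v).1
          · intro he
            have hns : ¬ G.IsSink (G.tail e) := fun h => h e rfl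
            exact ⟨⟨G.tail e, hns⟩, (huniq ⟨G.tail e, hns⟩ e ⟨he, rfl⟩).symm⟩
        refine ⟨⟨fun v => ⟨f v, (hf v).2⟩, ?_⟩, Subtype.ext hE⟩
        rw [IsAcyclicRotor, hE]
        exact hac)

/-- A cyclic ordering of the edges emanating from each vertex: `next e` is the edge after `e`,
and the cycles of `next` are exactly the sets of edges with a common tail. -/
structure CyclicOrdering where
  next : Equiv.Perm E
  sameCycle_iff : ∀ e f : E, next.SameCycle e f ↔ G.tail e = G.tail f

namespace CyclicOrdering

variable {G} (R : G.CyclicOrdering)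

theorem tail_next (e : E) : G.tail (R.next e) = G.tail e :=
  ((R.sameCycle_iff e (R.next e)).1 ⟨1, by simp⟩).symm

open Classical in
/-- Advance the rotor at `v` to the next edge. -/
noncomputable def advance (ρ : G.RotorConfig) (v : G.NonSink) : G.RotorConfig :=
  Function.update ρ v ⟨R.next (ρ v), (R.tail_next _).trans (ρ v).2⟩

open Classical in
/-- The rotor-router operation on single-chip-and-rotor states: advance the rotor at the chip's
location, then move the chip along it. States with the chip at a sink are absorbing. -/
noncomputable def step (x : V × G.RotorConfig) : V × G.RotorConfig :=
  if h : G.IsSink x.1 then x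
  else (G.head (R.next (x.2 ⟨x.1, h⟩)), R.advance x.2 ⟨x.1, h⟩)

/-- A chip started at `v` with rotors `ρ` arrives at a sink. -/
def ReachesSink (v : G.NonSink) (ρ : G.RotorConfig) : Prop :=
  ∃ n : ℕ, G.IsSink (R.step^[n] (v, ρ)).1

open Classical in
/-- The chip addition operator `E_v` on rotor configurations: add a chip at `v`, iterate the
rotor-router operation until the chip is at the sink, and keep the resulting rotors.
(The second branch is a default for the case that the chip never arrives.) -/
noncomputable def chipAddition (v : G.NonSink) (ρ : G.RotorConfig) : G.RotorConfig :=
  if h : R.ReachesSink v ρ then (R.step^[Nat.find h] (v, ρ)).2 else ρ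

open Classical in
/-- Firing in a chip-and-rotor state: at a vertex `v` that has a chip, the rotor is advanced and
one chip moves from `v` along it, disappearing if it arrives at a sink. -/
def Fires (x y : G.ChipConfig × G.RotorConfig) : Prop :=
  ∃ v : G.NonSink, 0 < x.1 v ∧
    y = (fun u => x.1 u - (if u = v then 1 else 0)
          + (if (u : V) = G.head (R.next (x.2 v)) then 1 else 0),
        R.advance x.2 v)

/-- `ρ' = σ(ρ)`: adding `σ v` chips at each `v` to `ρ` and routing all of them to the sink, in
some order, leads to `ρ'`. -/
def RoutesTo (σ : G.ChipConfig) (ρ ρ' : G.RotorConfig) : Prop :=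
  Relation.ReflTransGen R.Fires (σ, ρ) (0, ρ')

/-- The permutation `π` of the oriented spanning trees is the one given by `E_v`. -/
def IsChipAdditionPerm (v : G.NonSink) (π : Equiv.Perm G.OrientedSpanningTree) : Prop :=
  ∀ ρ : {ρ : G.RotorConfig // G.IsAcyclicRotor ρ},
    (π (G.treeEquiv ρ) : Set E) = G.rotorEdges (R.chipAddition v ρ)

/-- The rotor-router group: the group of permutations of oriented spanning trees generated by the
chip addition operators. -/
def rotorRouterGroup : Subgroup (Equiv.Perm G.OrientedSpanningTree) :=
  Subgroup.closure {π | ∃ v : G.NonSink, R.IsChipAdditionPerm v π}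

end CyclicOrdering

end MultiDigraph

/-!
Firings at different vertices commute, so the outcome of routing does not depend on the order. When
the rotor at each `v` makes `a v` full turns, `v` sends `a v` chips along each of its edges: the
rotors are unchanged and the chips change by a combination of rows of the Laplacian. A cyclic
sequence of firings would consist of full turns that leave the chips unchanged, which forces
`a = 0`; as a single chip has finitely many states, it reaches the sink. Similarly, two chip
configurations with the same effect on some rotors differ by full turns, hence have the same class,
and configurations with the same class act in the same way. So the sandpile group and the
rotor-router group are quotients of the monoid of chip configurations by the same congruence, and
the action is free.

For the bijectivity of `E_v`, let a chip that arrives at the sink start again at `v`. Then the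
rotors of the augmented graph form a unicycle through the chip, and a step can be undone by going
backwards along the cycle. `E_v` is a first return map of this injective process.
-/

section General

theorem exists_rank_of_reflTransGen {α : Type*} {r : α → α → Prop} {s : α}
    (h : ∀ a, Relation.ReflTransGen r a s) : ∃ d : α → ℕ, ∀ a ≠ s, ∃ b, r a b ∧ d b < d a := by
  classical
  let P : ℕ → α → Prop := fun n => (fun Q a => ∃ b, r a b ∧ Q b)^[n] (· = s)
  have hP : ∀ a, ∃ n, P n a := fun a => by
    induction h a using Relation.ReflTransGen.head_induction_on with
    | refl => exact ⟨0, rfl⟩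
    | head hab _ ih =>
      obtain ⟨n, hn⟩ := ih
      refine ⟨n + 1, ?_⟩
      simp only [P, Function.iterate_succ_apply']
      exact ⟨_, hab, hn⟩
  refine ⟨fun a => Nat.find (hP a), fun a ha => ?_⟩
  have hspec := Nat.find_spec (hP a)
  rcases hn : Nat.find (hP a) with _ | n
  · rw [hn] at hspec
    exact absurd hspec ha
  · rw [hn] at hspec
    simp only [P, Function.iterate_succ_apply'] at hspec
    obtain ⟨b, hab, hb⟩ := hspec
    have hlt : Nat.find (hP b) < Nat.find (hP a) := by
      rw [hn]
      exact Nat.lt_succ_of_le (Nat.find_min' _ hb)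
    exact ⟨b, hab, hlt⟩

theorem eq_of_firstReturn_eq {α : Type*} {f : α → α} {S A : Set α} (hmaps : Set.MapsTo f S S)
    (hinj : Set.InjOn f S) {x y : α} (hx : x ∈ S ∩ A) (hy : y ∈ S ∩ A) {m n : ℕ}
    (hxA : ∀ i < m, f^[i + 1] x ∉ A) (hyA : ∀ i < n, f^[i + 1] y ∉ A)
    (h : f^[m + 1] x = f^[n + 1] y) : x = y := by
  wlog hmn : m ≤ n generalizing x y m n
  · exact (this hy hx hyA hxA h.symm (le_of_not_ge hmn)).symm
  obtain ⟨d, rfl⟩ := Nat.exists_eq_add_of_le hmn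
  rw [show m + d + 1 = m + 1 + d by omega, Function.iterate_add_apply f (m + 1) d] at h
  have hxy : x = f^[d] y := hinj.iterate hmaps (m + 1) hx.1 (hmaps.iterate d hy.1) h
  cases d with
  | zero => exact hxy
  | succ d => exact absurd (hxy ▸ hx.2) (hyA d (by omega))

theorem birkhoffSum_card_of_isCycleOn {α M : Type*} [AddCommMonoid M] {f : Equiv.Perm α}
    {t : Finset α} (hf : f.IsCycleOn t) {a : α} (ha : a ∈ t) (g : α → M) :
    birkhoffSum f g t.card a = ∑ x ∈ t, g x := by
  have hmem : ∀ n : ℕ, (f ^ n) a ∈ t := fun n => (hf.1.perm_pow n).mapsTo ha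
  refine Finset.sum_nbij (fun n => f^[n] a) ?_ ?_ ?_ fun _ _ => rfl
  · intro n _
    rw [Equiv.Perm.iterate_eq_pow]
    exact hmem n
  · intro m hm n hn hmn
    simp only [Equiv.Perm.iterate_eq_pow] at hmn
    exact ((hf.pow_apply_eq_pow_apply ha).1 hmn).eq_of_lt_of_lt (Finset.mem_range.1 hm)
      (Finset.mem_range.1 hn)
  · intro b hb
    obtain ⟨n, hn, rfl⟩ := hf.exists_pow_eq ha hb
    exact ⟨n, Finset.mem_coe.2 (Finset.mem_range.2 hn), by simp only [Equiv.Perm.iterate_eq_pow]⟩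

theorem birkhoffSum_mul_card_of_isCycleOn {α M : Type*} [AddCommMonoid M] {f : Equiv.Perm α}
    {t : Finset α} (hf : f.IsCycleOn t) {a : α} (ha : a ∈ t) (g : α → M) (k : ℕ) :
    birkhoffSum f g (k * t.card) a = k • ∑ x ∈ t, g x := by
  induction k with
  | zero => simp
  | succ k ih =>
    rw [Nat.succ_mul, birkhoffSum_add, ih, succ_nsmul, Equiv.Perm.iterate_eq_pow,
      (hf.pow_apply_eq ha).2 (Dvd.intro_left k rfl), birkhoffSum_card_of_isCycleOn hf ha]

/-- Two surjective homomorphisms on a monoid that identify the same pairs of elements have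
isomorphic targets. -/
noncomputable def mulEquivOfSurjective {M N P : Type*} [Monoid M] [Monoid N] [Monoid P]
    (f : M →* N) (g : M →* P) (hf : Function.Surjective f) (hg : Function.Surjective g)
    (h : ∀ a b, f a = f b ↔ g a = g b) : N ≃* P :=
  (Con.quotientKerEquivOfSurjective f hf).symm.trans
    ((Con.congr (.refl M) (Con.ext h)).trans (Con.quotientKerEquivOfSurjective g hg))

theorem mulEquivOfSurjective_apply {M N P : Type*} [Monoid M] [Monoid N] [Monoid P]
    (f : M →* N) (g : M →* P) (hf : Function.Surjective f) (hg : Function.Surjective g)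
    (h : ∀ a b, f a = f b ↔ g a = g b) (a : M) : mulEquivOfSurjective f g hf hg h (f a) = g a := by
  have : (Con.quotientKerEquivOfSurjective f hf).symm (f a) = (a : (Con.ker f).Quotient) :=
    (MulEquiv.symm_apply_eq _).2 rfl
  simp only [mulEquivOfSurjective, MulEquiv.trans_apply, this]
  rfl

end General

namespace MultiDigraph

variable {V : Type*} {E : Type*} (G : MultiDigraph V E)

section Chips

open Classical in
/-- One chip at `w`, or none if `w` is a sink: the effect of a chip arriving at `w`. -/
noncomputable def chipAt (w : V) : G.ChipConfig := fun u => if (u : V) = w then 1 else 0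

theorem chipAt_coe (v : G.NonSink) : G.chipAt v = G.singleChip v := by
  funext u
  by_cases h : u = v
  · simp [chipAt, singleChip, h]
  · simp [chipAt, singleChip, h, Subtype.coe_inj.not.2 h]

theorem chipAt_self (v : G.NonSink) : G.chipAt v v = 1 := by simp [chipAt]

theorem chipAt_of_ne {u v : G.NonSink} (h : u ≠ v) : G.chipAt v u = 0 := by
  simp [chipAt, Subtype.ext_iff.not.1 h]

theorem chipAt_of_isSink {w : V} (h : G.IsSink w) : G.chipAt w = 0 := by
  funext u
  have hu : (u : V) ≠ w := fun hu => u.2 (hu ▸ h)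
  simp [chipAt, hu]

theorem sum_chipAt_le_one [Fintype G.NonSink] (w : V) : ∑ u, G.chipAt w u ≤ 1 := by
  by_cases h : G.IsSink w
  · simp [G.chipAt_of_isSink h]
  · refine (Fintype.sum_eq_single (⟨w, h⟩ : G.NonSink) fun u hu => ?_).trans_le ?_
    · exact G.chipAt_of_ne hu
    · exact (G.chipAt_self ⟨w, h⟩).le

theorem exists_eq_chipAt_add {σ : G.ChipConfig} {v : G.NonSink} (h : 0 < σ v) :
    ∃ τ, σ = G.chipAt v + τ := by
  refine ⟨σ - G.chipAt v, funext fun u => ?_⟩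
  by_cases hu : u = v
  · subst hu
    simp only [Pi.add_apply, Pi.sub_apply, chipAt_self]
    omega
  · simp [G.chipAt_of_ne hu]

theorem chipConfig_induction [Finite G.NonSink] {P : G.ChipConfig → Prop} (zero : P 0)
    (add : ∀ σ τ, P σ → P τ → P (σ + τ)) (chip : ∀ v : G.NonSink, P (G.chipAt v))
    (σ : G.ChipConfig) : P σ := by
  classical
  refine Pi.single_induction P σ zero add (fun v n => ?_)
  induction n with
  | zero => simpa using zero
  | succ n ih =>
    have hsucc : (Pi.single v (n + 1) : G.ChipConfig) = Pi.single v n + G.chipAt v := by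
      rw [Pi.single_add, chipAt_coe, singleChip]
    rw [hsucc]
    exact add _ _ ih (chip v)

open Classical in
theorem outdeg_eq_card [Fintype E] (v : V) : G.outdeg v = Finset.card {e | G.tail e = v} := by
  rw [outdeg, Nat.card_eq_fintype_card, Fintype.card_subtype]

open Classical in
theorem sum_chipAt_head_apply [Fintype E] (v : V) (w : G.NonSink) :
    (∑ e with G.tail e = v, G.chipAt (G.head e)) w = G.edgeCount v w := by
  rw [edgeCount, Nat.card_eq_fintype_card, Fintype.card_subtype, Finset.sum_apply,
    ← Finset.filter_filter, Finset.card_filter]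
  simp only [chipAt, eq_comm]

theorem edgeCount_tail_head_pos [Finite E] (e : E) : 0 < G.edgeCount (G.tail e) (G.head e) :=
  have : Nonempty {f : E // G.tail f = G.tail e ∧ G.head f = G.head e} := ⟨e, rfl, rfl⟩
  Nat.card_pos

open Classical in
theorem sum_edgeCount [Fintype E] [Fintype G.NonSink] (v : V) :
    ∑ w : G.NonSink, G.edgeCount v w = ∑ e with G.tail e = v, ∑ w, G.chipAt (G.head e) w := by
  rw [Finset.sum_comm]
  refine Finset.sum_congr rfl fun w _ => ?_
  rw [← sum_chipAt_head_apply, Finset.sum_apply]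

theorem sum_edgeCount_le_outdeg [Finite E] [Fintype G.NonSink] (v : V) :
    ∑ w : G.NonSink, G.edgeCount v w ≤ G.outdeg v := by
  classical
  have := Fintype.ofFinite E
  rw [sum_edgeCount, outdeg_eq_card, Finset.card_eq_sum_ones]
  exact Finset.sum_le_sum fun e _ => G.sum_chipAt_le_one _

theorem sum_edgeCount_lt_outdeg [Finite E] [Fintype G.NonSink] {e : E}
    (he : G.IsSink (G.head e)) :
    ∑ w : G.NonSink, G.edgeCount (G.tail e) w < G.outdeg (G.tail e) := by
  classical
  have := Fintype.ofFinite E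
  rw [sum_edgeCount, outdeg_eq_card, Finset.card_eq_sum_ones]
  refine Finset.sum_lt_sum (fun e _ => G.sum_chipAt_le_one _) ⟨e, by simp, ?_⟩
  simp [G.chipAt_of_isSink he]

end Chips

section SandpileGroup

/-- The homomorphism sending a chip configuration to its class. -/
noncomputable def chipClassHom : G.ChipConfig →+ G.SandpileGroup :=
  (QuotientAddGroup.mk' _).comp ((Nat.castAddMonoidHom ℤ).compLeft G.NonSink)

theorem chipClassHom_apply (σ : G.ChipConfig) : G.chipClassHom σ = G.chipClass σ := rfl

theorem chipClass_add (σ τ : G.ChipConfig) :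
    G.chipClass (σ + τ) = G.chipClass σ + G.chipClass τ :=
  map_add G.chipClassHom σ τ

theorem exists_chipClass_eq_add (g : G.SandpileGroup) :
    ∃ σ κ : G.ChipConfig, G.chipClass σ = g + G.chipClass κ := by
  obtain ⟨x, rfl⟩ := QuotientAddGroup.mk_surjective g
  refine ⟨fun v => (x v).toNat, fun v => (-x v).toNat, ?_⟩
  rw [chipClass, chipClass, ← QuotientAddGroup.mk_add]
  congr 1
  funext v
  simp only [Pi.add_apply]
  omega

/-- The chips that arrive when every `v` sends `a v` chips along each of its outgoing edges. -/
noncomputable def fullTurnOutput [Fintype G.NonSink] (a : G.ChipConfig) : G.ChipConfig :=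
  fun w => ∑ v, a v * G.edgeCount v w

/-- The number of chips each vertex needs for `a` full turns of its rotor. -/
noncomputable def fullTurns (a : G.ChipConfig) : G.ChipConfig := fun v => a v * G.outdeg v

theorem sum_zsmul_reducedLaplacian [Fintype G.NonSink] (c : G.NonSink → ℤ) (w : G.NonSink) :
    (∑ v, c v • G.reducedLaplacian v) w = c w * G.outdeg w - ∑ v, c v * G.edgeCount v w := by
  classical
  simp only [Finset.sum_apply, Pi.smul_apply, smul_eq_mul, reducedLaplacian, laplacian,
    Matrix.submatrix_apply, Matrix.sub_apply, Matrix.of_apply, mul_sub, Finset.sum_sub_distrib]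
  rw [Finset.sum_eq_single w (fun v _ hv => ?_) (by simp), Matrix.diagonal_apply_eq]
  rw [Matrix.diagonal_apply_ne _ fun h => hv (Subtype.ext h), mul_zero]

theorem chipClass_eq_iff_exists_int [Fintype G.NonSink] {σ κ : G.ChipConfig} :
    G.chipClass σ = G.chipClass κ ↔ ∃ c : G.NonSink → ℤ, ∀ w : G.NonSink,
      (κ w : ℤ) - σ w = c w * G.outdeg w - ∑ v, c v * G.edgeCount v w := by
  rw [chipClass, chipClass, QuotientAddGroup.eq, AddSubgroup.mem_closure_range_iff_of_fintype]
  refine exists_congr fun c => funext_iff.trans (forall_congr' fun w => ?_)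
  rw [sum_zsmul_reducedLaplacian, Pi.add_apply, Pi.neg_apply, neg_add_eq_sub]

theorem chipClass_eq_iff [Fintype G.NonSink] {σ κ : G.ChipConfig} :
    G.chipClass σ = G.chipClass κ ↔ ∃ a b, σ + G.fullTurns a + G.fullTurnOutput b =
      κ + G.fullTurns b + G.fullTurnOutput a := by
  have hbalance (a b : G.ChipConfig) : σ + G.fullTurns a + G.fullTurnOutput b =
      κ + G.fullTurns b + G.fullTurnOutput a ↔ ∀ w : G.NonSink, (κ w : ℤ) - σ w =
        ((a w : ℤ) - b w) * G.outdeg w - ∑ v, ((a v : ℤ) - b v) * G.edgeCount v w := by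
    refine funext_iff.trans (forall_congr' fun w => ?_)
    simp only [Pi.add_apply, fullTurns, fullTurnOutput, sub_mul, Finset.sum_sub_distrib]
    zify
    constructor <;> intro h <;> linarith
  rw [chipClass_eq_iff_exists_int]
  constructor
  · rintro ⟨c, hc⟩
    refine ⟨fun v => (c v).toNat, fun v => (-c v).toNat, (hbalance _ _).2 ?_⟩
    simpa only [Int.toNat_sub_toNat_neg] using hc
  · rintro ⟨a, b, h⟩
    exact ⟨_, (hbalance a b).1 h⟩

theorem chipClass_fullTurns [Fintype G.NonSink] (a : G.ChipConfig) :
    G.chipClass (G.fullTurns a) = G.chipClass (G.fullTurnOutput a) :=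
  G.chipClass_eq_iff.2 ⟨0, a, by
    funext w
    simp [fullTurns, fullTurnOutput, add_comm]⟩

theorem eq_zero_of_fullTurnOutput_eq_fullTurns [Finite E] [Fintype G.NonSink] {s : V}
    (hs : G.IsGlobalSink s) {a : G.ChipConfig} (h : G.fullTurnOutput a = G.fullTurns a) :
    a = 0 := by
  suffices hzero : ∀ (u : V) (hu : ¬ G.IsSink u), a ⟨u, hu⟩ = 0 from
    funext fun v => hzero v v.2
  intro u
  induction hs.2 u using Relation.ReflTransGen.head_induction_on with
  | refl => exact fun hu => absurd hs.1 hu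
  | head hedge _ ih =>
    obtain ⟨e, -, rfl, rfl⟩ := hedge
    intro hu
    by_cases hhead : G.IsSink (G.head e)
    · -- If `a` were positive here, then fewer chips would arrive than leave.
      by_contra hpos
      have hlt : ∑ v, a v * ∑ w : G.NonSink, G.edgeCount v w < ∑ v, a v * G.outdeg v :=
        Finset.sum_lt_sum (fun v _ => Nat.mul_le_mul_left _ (G.sum_edgeCount_le_outdeg v))
          ⟨⟨G.tail e, hu⟩, Finset.mem_univ _,
            Nat.mul_lt_mul_of_pos_left (G.sum_edgeCount_lt_outdeg hhead) (Nat.pos_of_ne_zero hpos)⟩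
      refine hlt.ne ?_
      simp only [Finset.mul_sum]
      rw [Finset.sum_comm]
      exact Finset.sum_congr rfl fun w _ => congrFun h w
    · have hsum : ∑ v, a v * G.edgeCount v (G.head e) = 0 := by
        simpa only [fullTurnOutput, fullTurns, ih hhead, zero_mul] using
          congrFun h ⟨G.head e, hhead⟩
      have hmul := Finset.sum_eq_zero_iff.1 hsum ⟨G.tail e, hu⟩ (Finset.mem_univ _)
      exact (Nat.mul_eq_zero.1 hmul).resolve_right (G.edgeCount_tail_head_pos e).ne'

end SandpileGroup

section Firing

namespace CyclicOrdering

variable {G} (R : G.CyclicOrdering)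

theorem advance_self (ρ : G.RotorConfig) (v : G.NonSink) :
    (R.advance ρ v v : E) = R.next (ρ v) := by simp [advance]

theorem advance_of_ne (ρ : G.RotorConfig) {u v : G.NonSink} (h : u ≠ v) :
    R.advance ρ v u = ρ u := by simp [advance, h]

theorem advance_comm (ρ : G.RotorConfig) (v w : G.NonSink) :
    R.advance (R.advance ρ v) w = R.advance (R.advance ρ w) v := by
  classical
  by_cases hvw : v = w
  · rw [hvw]
  · simp only [advance, Function.update_of_ne hvw, Function.update_of_ne (Ne.symm hvw)]
    exact Function.update_comm hvw _ _ _

theorem advance_injective (v : G.NonSink) : Function.Injective fun ρ => R.advance ρ v := by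
  intro ρ ρ' h
  funext u
  have hu := congrFun h u
  by_cases huv : u = v
  · subst huv
    have hnext := congrArg Subtype.val hu
    simp only [advance_self] at hnext
    exact Subtype.ext (R.next.injective hnext)
  · simpa only [R.advance_of_ne _ huv] using hu

theorem fires_iff {σ : G.ChipConfig} {ρ : G.RotorConfig} {y : G.ChipConfig × G.RotorConfig} :
    R.Fires (σ, ρ) y ↔ ∃ (v : G.NonSink) (τ : G.ChipConfig), σ = G.chipAt v + τ ∧
      y = (τ + G.chipAt (G.head (R.next (ρ v))), R.advance ρ v) := by
  classical
  have hchips (v : G.NonSink) (τ : G.ChipConfig) :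
      (fun u => (G.chipAt v + τ) u - (if u = v then 1 else 0)
        + (if (u : V) = G.head (R.next (ρ v)) then 1 else 0)) =
      τ + G.chipAt (G.head (R.next (ρ v))) := by
    funext u
    simp only [Pi.add_apply, chipAt, Subtype.coe_inj]
    split_ifs <;> omega
  constructor
  · rintro ⟨v, hv, rfl⟩
    obtain ⟨τ, rfl⟩ := G.exists_eq_chipAt_add hv
    refine ⟨v, τ, rfl, Prod.ext ?_ rfl⟩
    convert hchips v τ
  · rintro ⟨v, τ, rfl, rfl⟩
    refine ⟨v, by simp [chipAt_self], Prod.ext ?_ rfl⟩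
    convert (hchips v τ).symm

theorem fires_chipAt_add (v : G.NonSink) (τ : G.ChipConfig) (ρ : G.RotorConfig) :
    R.Fires (G.chipAt v + τ, ρ) (τ + G.chipAt (G.head (R.next (ρ v))), R.advance ρ v) :=
  R.fires_iff.2 ⟨v, τ, rfl, rfl⟩

theorem fires_diamond {a b c : G.ChipConfig × G.RotorConfig} (hb : R.Fires a b)
    (hc : R.Fires a c) : b = c ∨ ∃ d, R.Fires b d ∧ R.Fires c d := by
  obtain ⟨σ, ρ⟩ := a
  obtain ⟨v, τ, rfl, rfl⟩ := R.fires_iff.1 hb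
  obtain ⟨w, τ', hσ, rfl⟩ := R.fires_iff.1 hc
  by_cases hvw : v = w
  · subst hvw
    exact .inl (by rw [add_left_cancel hσ])
  right
  have hpos : 0 < τ w := by
    have := congrFun hσ w
    simp only [Pi.add_apply, chipAt_self, G.chipAt_of_ne (Ne.symm hvw)] at this
    omega
  obtain ⟨κ, rfl⟩ := G.exists_eq_chipAt_add hpos
  obtain rfl : G.chipAt v + κ = τ' := by
    rw [add_left_comm] at hσ
    exact add_left_cancel hσ
  refine ⟨(κ + G.chipAt (G.head (R.next (ρ v))) + G.chipAt (G.head (R.next (ρ w))),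
    R.advance (R.advance ρ v) w), ?_, ?_⟩
  · have := R.fires_chipAt_add w (κ + G.chipAt (G.head (R.next (ρ v)))) (R.advance ρ v)
    rwa [R.advance_of_ne ρ (Ne.symm hvw), ← add_assoc] at this
  · have := R.fires_chipAt_add v (κ + G.chipAt (G.head (R.next (ρ w)))) (R.advance ρ w)
    rwa [R.advance_of_ne ρ hvw, ← add_assoc, R.advance_comm ρ w v, add_right_comm κ] at this

/-- `y` is obtained from `x` by finitely many firings; chips may be left over. -/
abbrev Routes (x y : G.ChipConfig × G.RotorConfig) : Prop := Relation.ReflTransGen R.Fires x y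

variable {R}

theorem Routes.join {a b c : G.ChipConfig × G.RotorConfig} (hb : R.Routes a b)
    (hc : R.Routes a c) : Relation.Join R.Routes b c := by
  refine Relation.church_rosser (fun a b c hb hc => ?_) hb hc
  rcases R.fires_diamond hb hc with rfl | ⟨d, hbd, hcd⟩
  · exact ⟨b, .refl, .refl⟩
  · exact ⟨d, .single hbd, .single hcd⟩

theorem Routes.eq_of_zero {ρ : G.RotorConfig} {y : G.ChipConfig × G.RotorConfig}
    (h : R.Routes (0, ρ) y) : y = (0, ρ) := by
  rcases h.cases_head with h | ⟨c, ⟨v, hv, -⟩, -⟩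
  · exact h.symm
  · exact absurd hv (by simp)

theorem Routes.add_right {σ τ : G.ChipConfig} {ρ ρ' : G.RotorConfig}
    (h : R.Routes (σ, ρ) (τ, ρ')) (κ : G.ChipConfig) : R.Routes (σ + κ, ρ) (τ + κ, ρ') := by
  refine Relation.ReflTransGen.lift (r := R.Fires)
    (fun x : G.ChipConfig × G.RotorConfig => (x.1 + κ, x.2)) ?_ _ _ h
  rintro ⟨σ, ρ⟩ y hy
  obtain ⟨v, τ, rfl, rfl⟩ := R.fires_iff.1 hy
  exact R.fires_iff.2 ⟨v, τ + κ, add_assoc _ _ _, by simp only [add_right_comm]⟩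

theorem RoutesTo.of_routes {σ τ : G.ChipConfig} {ρ ρ₁ ρ' : G.RotorConfig}
    (h : R.RoutesTo σ ρ ρ') (h' : R.Routes (σ, ρ) (τ, ρ₁)) : R.RoutesTo τ ρ₁ ρ' := by
  obtain ⟨d, hd, hd'⟩ := Routes.join h h'
  rwa [hd.eq_of_zero] at hd'

theorem RoutesTo.unique {σ : G.ChipConfig} {ρ ρ₁ ρ₂ : G.RotorConfig}
    (h₁ : R.RoutesTo σ ρ ρ₁) (h₂ : R.RoutesTo σ ρ ρ₂) : ρ₁ = ρ₂ :=
  congrArg Prod.snd (Routes.eq_of_zero (h₂.of_routes h₁)).symm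

theorem RoutesTo.add {σ τ : G.ChipConfig} {ρ ρ₁ ρ₂ : G.RotorConfig}
    (h : R.RoutesTo σ ρ ρ₁) (h' : R.RoutesTo τ ρ₁ ρ₂) : R.RoutesTo (σ + τ) ρ ρ₂ := by
  have hσ := Routes.add_right h τ
  rw [zero_add] at hσ
  exact hσ.trans h'

end CyclicOrdering

end Firing

section Odometer

namespace CyclicOrdering

variable {G} (R : G.CyclicOrdering)

theorem tail_iterate_next (n : ℕ) (e : E) : G.tail (R.next^[n] e) = G.tail e := by
  induction n with
  | zero => rfl
  | succ n ih => rw [Function.iterate_succ_apply', R.tail_next, ih]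

/-- The rotors after each vertex `v` has fired `n v` times. -/
def rotate (n : G.ChipConfig) (ρ : G.RotorConfig) : G.RotorConfig :=
  fun v => ⟨R.next^[n v] (ρ v), (R.tail_iterate_next _ _).trans (ρ v).2⟩

theorem rotate_zero (ρ : G.RotorConfig) : R.rotate 0 ρ = ρ := rfl

theorem rotate_add (m n : G.ChipConfig) (ρ : G.RotorConfig) :
    R.rotate (m + n) ρ = R.rotate n (R.rotate m ρ) := by
  funext v
  refine Subtype.ext ?_
  simp only [rotate, Pi.add_apply]
  rw [add_comm, Function.iterate_add_apply]

theorem rotate_chipAt (v : G.NonSink) (ρ : G.RotorConfig) :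
    R.rotate (G.chipAt v) ρ = R.advance ρ v := by
  funext u
  refine Subtype.ext ?_
  by_cases h : u = v
  · subst h
    simp [rotate, chipAt_self, advance_self]
  · simp [rotate, G.chipAt_of_ne h, R.advance_of_ne _ h]

/-- The chips that arrive when each vertex `v` fires `n v` times, starting with the rotors `ρ`. -/
noncomputable def emitted [Fintype G.NonSink] (n : G.ChipConfig) (ρ : G.RotorConfig) :
    G.ChipConfig :=
  ∑ v, birkhoffSum R.next (fun e => G.chipAt (G.head e)) (n v) (R.next (ρ v))

variable [Fintype G.NonSink]

theorem emitted_zero (ρ : G.RotorConfig) : R.emitted 0 ρ = 0 := by simp [emitted]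

theorem emitted_add (m n : G.ChipConfig) (ρ : G.RotorConfig) :
    R.emitted (m + n) ρ = R.emitted m ρ + R.emitted n (R.rotate m ρ) := by
  simp only [emitted, rotate, Pi.add_apply, birkhoffSum_add, Finset.sum_add_distrib,
    ← Function.iterate_succ_apply, ← Function.iterate_succ_apply']

theorem emitted_chipAt (v : G.NonSink) (ρ : G.RotorConfig) :
    R.emitted (G.chipAt v) ρ = G.chipAt (G.head (R.next (ρ v))) := by
  rw [emitted, Fintype.sum_eq_single v fun u hu => ?_, chipAt_self, birkhoffSum_one]
  rw [G.chipAt_of_ne hu, birkhoffSum_zero]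

theorem routes_rotate (n τ : G.ChipConfig) (ρ : G.RotorConfig) :
    R.Routes (n + τ, ρ) (τ + R.emitted n ρ, R.rotate n ρ) := by
  induction n using G.chipConfig_induction generalizing τ ρ with
  | zero =>
    rw [zero_add, emitted_zero, add_zero, rotate_zero]
  | add m n hm hn =>
    have hfirst := hm (n + τ) ρ
    have hsecond := hn (τ + R.emitted m ρ) (R.rotate m ρ)
    rw [← add_assoc] at hfirst hsecond
    rw [emitted_add, rotate_add, ← add_assoc]
    exact hfirst.trans hsecond
  | chip v =>
    rw [emitted_chipAt, rotate_chipAt]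
    exact .single (R.fires_chipAt_add v τ ρ)

/-- The numbers of firings `n v` account for the passage from `x` to `y`: together with the
chips left over, the chips fired make up the initial chips and the chips emitted. -/
def IsOdometer (n : G.ChipConfig) (x y : G.ChipConfig × G.RotorConfig) : Prop :=
  x.1 + R.emitted n x.2 = y.1 + n ∧ y.2 = R.rotate n x.2

variable {R}

theorem IsOdometer.add {m n : G.ChipConfig} {x y z : G.ChipConfig × G.RotorConfig}
    (hm : R.IsOdometer m x y) (hn : R.IsOdometer n y z) : R.IsOdometer (m + n) x z := by
  refine ⟨?_, by rw [rotate_add, ← hm.2, hn.2]⟩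
  rw [emitted_add, ← hm.2, ← add_assoc, hm.1, add_right_comm, hn.1, add_right_comm, add_assoc]

theorem exists_isOdometer_of_fires {x y : G.ChipConfig × G.RotorConfig} (h : R.Fires x y) :
    ∃ v : G.NonSink, R.IsOdometer (G.chipAt v) x y := by
  obtain ⟨σ, ρ⟩ := x
  obtain ⟨v, τ, rfl, rfl⟩ := R.fires_iff.1 h
  refine ⟨v, ?_, (R.rotate_chipAt v ρ).symm⟩
  rw [emitted_chipAt, add_assoc (G.chipAt v), add_comm]

theorem Routes.exists_isOdometer {x y : G.ChipConfig × G.RotorConfig} (h : R.Routes x y) :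
    ∃ n, R.IsOdometer n x y := by
  induction h with
  | refl => exact ⟨0, by rw [emitted_zero], rfl⟩
  | tail _ hfires ih =>
    obtain ⟨n, hn⟩ := ih
    obtain ⟨v, hv⟩ := exists_isOdometer_of_fires hfires
    exact ⟨n + G.chipAt v, hn.add hv⟩

theorem exists_isOdometer_ne_zero_of_transGen {x y : G.ChipConfig × G.RotorConfig}
    (h : Relation.TransGen R.Fires x y) : ∃ n ≠ 0, R.IsOdometer n x y := by
  obtain ⟨z, hxz, hzy⟩ := Relation.TransGen.head'_iff.1 h
  obtain ⟨v, hv⟩ := exists_isOdometer_of_fires hxz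
  obtain ⟨n, hn⟩ := Routes.exists_isOdometer hzy
  refine ⟨_, fun hzero => ?_, hv.add hn⟩
  have := congrFun hzero v
  simp [chipAt_self] at this

end CyclicOrdering

end Odometer

section FullTurns

namespace CyclicOrdering

variable {G} (R : G.CyclicOrdering)

open Classical in
theorem isCycleOn_next [Fintype E] (v : V) :
    R.next.IsCycleOn (Finset.univ.filter fun e => G.tail e = v) := by
  rw [Finset.coe_filter_univ]
  refine ⟨R.next.bijOn fun e => ?_, fun e he f hf => ?_⟩
  · simp only [Set.mem_ofPred_eq, R.tail_next]
  · exact (R.sameCycle_iff e f).2 (he.trans hf.symm)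

theorem iterate_next_eq_iff [Finite E] (e : E) (m n : ℕ) :
    R.next^[m] e = R.next^[n] e ↔ m ≡ n [MOD G.outdeg (G.tail e)] := by
  classical
  have := Fintype.ofFinite E
  simp only [outdeg_eq_card, Equiv.Perm.iterate_eq_pow]
  exact (R.isCycleOn_next (G.tail e)).pow_apply_eq_pow_apply (by simp)

theorem rotate_eq_rotate_iff [Finite E] {m n : G.ChipConfig} {ρ : G.RotorConfig} :
    R.rotate m ρ = R.rotate n ρ ↔ ∀ v : G.NonSink, m v ≡ n v [MOD G.outdeg v] := by
  refine funext_iff.trans (forall_congr' fun v => Subtype.ext_iff.trans ?_)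
  rw [rotate, rotate, iterate_next_eq_iff, (ρ v).2]

theorem rotate_fullTurns [Finite E] (a : G.ChipConfig) (ρ : G.RotorConfig) :
    R.rotate (G.fullTurns a) ρ = ρ :=
  R.rotate_eq_rotate_iff (n := 0).2 fun _ => Nat.modEq_zero_iff_dvd.2 (Dvd.intro_left _ rfl)

theorem exists_rotate_eq [Finite E] (ρ ρ' : G.RotorConfig) : ∃ n, R.rotate n ρ = ρ' := by
  have hedge (v : G.NonSink) : ∃ n : ℕ, R.next^[n] (ρ v) = ρ' v := by
    have hsame := (R.sameCycle_iff (ρ v) (ρ' v)).2 ((ρ v).2.trans (ρ' v).2.symm)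
    obtain ⟨n, hn⟩ := hsame.exists_nat_pow_eq
    exact ⟨n, by rw [Equiv.Perm.iterate_eq_pow, hn]⟩
  choose n hn using hedge
  exact ⟨n, funext fun v => Subtype.ext (hn v)⟩

theorem emitted_fullTurns [Finite E] [Fintype G.NonSink] (a : G.ChipConfig) (ρ : G.RotorConfig) :
    R.emitted (G.fullTurns a) ρ = G.fullTurnOutput a := by
  classical
  have := Fintype.ofFinite E
  funext w
  simp only [emitted, Finset.sum_apply]
  refine Finset.sum_congr rfl fun v _ => ?_
  have hmem : R.next (ρ v) ∈ Finset.univ.filter fun e => G.tail e = v := by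
    simp [R.tail_next, (ρ v).2]
  rw [fullTurns, outdeg_eq_card,
    birkhoffSum_mul_card_of_isCycleOn (R.isCycleOn_next (v : V)) hmem, Pi.smul_apply,
    sum_chipAt_head_apply, smul_eq_mul]

theorem routes_fullTurns [Finite E] [Fintype G.NonSink] (a : G.ChipConfig) (ρ : G.RotorConfig) :
    R.Routes (G.fullTurns a, ρ) (G.fullTurnOutput a, ρ) := by
  simpa only [add_zero, zero_add, emitted_fullTurns, rotate_fullTurns] using
    R.routes_rotate (G.fullTurns a) 0 ρ

theorem chipClass_add_emitted_eq_of_rotate_eq [Finite E] [Fintype G.NonSink]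
    {m n : G.ChipConfig} {ρ : G.RotorConfig} (h : R.rotate m ρ = R.rotate n ρ) :
    G.chipClass (m + R.emitted n ρ) = G.chipClass (n + R.emitted m ρ) := by
  obtain ⟨r, a, b, rfl, rfl⟩ : ∃ r a b, m = r + G.fullTurns a ∧ n = r + G.fullTurns b := by
    refine ⟨fun v => m v % G.outdeg v, fun v => m v / G.outdeg v, fun v => n v / G.outdeg v,
      funext fun v => (Nat.mod_add_div' _ _).symm, funext fun v => ?_⟩
    have hrem : m v % G.outdeg v = n v % G.outdeg v := R.rotate_eq_rotate_iff.1 h v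
    simp only [Pi.add_apply, fullTurns, hrem, Nat.mod_add_div']
  simp only [emitted_add, emitted_fullTurns, chipClass_add, chipClass_fullTurns]
  abel

theorem chipClass_eq_of_routesTo [Finite E] [Finite G.NonSink] {σ κ : G.ChipConfig}
    {ρ ρ' : G.RotorConfig} (hσ : R.RoutesTo σ ρ ρ') (hκ : R.RoutesTo κ ρ ρ') :
    G.chipClass σ = G.chipClass κ := by
  have := Fintype.ofFinite G.NonSink
  obtain ⟨m, hm, hmρ⟩ := Routes.exists_isOdometer hσ
  obtain ⟨n, hn, hnρ⟩ := Routes.exists_isOdometer hκ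
  have hmn := R.chipClass_add_emitted_eq_of_rotate_eq (hmρ.symm.trans hnρ)
  simp only [zero_add] at hm hn
  refine add_right_cancel (b := G.chipClass (R.emitted m ρ + R.emitted n ρ)) ?_
  rw [← chipClass_add, ← chipClass_add, ← add_assoc, hm, add_comm (R.emitted m ρ), ← add_assoc, hn]
  exact hmn

end CyclicOrdering

end FullTurns

section Termination

namespace CyclicOrdering

variable {G} (R : G.CyclicOrdering)

theorem not_transGen_fires_self [Finite E] [Finite G.NonSink] {s : V} (hs : G.IsGlobalSink s)
    (x : G.ChipConfig × G.RotorConfig) : ¬ Relation.TransGen R.Fires x x := by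
  intro h
  have := Fintype.ofFinite G.NonSink
  obtain ⟨n, hn, hchips, hrotors⟩ := exists_isOdometer_ne_zero_of_transGen h
  have hdvd (v : G.NonSink) : G.outdeg v ∣ n v :=
    Nat.modEq_zero_iff_dvd.1 (R.rotate_eq_rotate_iff (n := 0).1 hrotors.symm v)
  choose a ha using hdvd
  obtain rfl : n = G.fullTurns a := funext fun v => (ha v).trans (mul_comm _ _)
  rw [emitted_fullTurns] at hchips
  have hzero : a = 0 := G.eq_zero_of_fullTurnOutput_eq_fullTurns hs (add_left_cancel hchips)
  exact hn (funext fun v => by simp [fullTurns, hzero])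

theorem step_of_isSink {x : V × G.RotorConfig} (h : G.IsSink x.1) : R.step x = x := by
  simp [step, h]

theorem step_of_not_isSink {w : V} {ρ : G.RotorConfig} (h : ¬ G.IsSink w) :
    R.step (w, ρ) = (G.head (R.next (ρ ⟨w, h⟩)), R.advance ρ ⟨w, h⟩) := by
  simp [step, h]

theorem fires_step {x : V × G.RotorConfig} (h : ¬ G.IsSink x.1) :
    R.Fires (G.chipAt x.1, x.2) (G.chipAt (R.step x).1, (R.step x).2) := by
  obtain ⟨w, ρ⟩ := x
  rw [R.step_of_not_isSink h]
  simpa only [add_zero, zero_add] using R.fires_chipAt_add ⟨w, h⟩ 0 ρ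

theorem reachesSink [Finite V] [Finite E] {s : V} (hs : G.IsGlobalSink s) (v : G.NonSink)
    (ρ : G.RotorConfig) : R.ReachesSink v ρ := by
  by_contra hnot
  obtain ⟨m, n, hmn, heq⟩ :=
    Finite.exists_ne_map_eq_of_infinite fun n => R.step^[n] ((v : V), ρ)
  wlog hlt : m < n generalizing m n
  · exact this n m hmn.symm heq.symm (lt_of_le_of_ne (not_lt.1 hlt) hmn.symm)
  let state : ℕ → G.ChipConfig × G.RotorConfig := fun i =>
    (G.chipAt (R.step^[i] ((v : V), ρ)).1, (R.step^[i] ((v : V), ρ)).2)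
  have hfires (i : ℕ) : R.Fires (state i) (state (i + 1)) := by
    simp only [state, Function.iterate_succ_apply']
    exact R.fires_step fun hsink => hnot ⟨i, hsink⟩
  have hcycle : Relation.TransGen R.Fires (state m) (state n) :=
    Relation.TransGen.lift state (fun _ _ h => h) _ _
      (transGen_of_succ_of_lt (fun i j => R.Fires (state i) (state j)) (fun i _ => hfires i) hlt)
  refine R.not_transGen_fires_self hs (state m) ?_
  have hstate : state n = state m := by simp only [state, heq]
  rwa [hstate] at hcycle

theorem routes_step_iterate (x : V × G.RotorConfig) (n : ℕ) :
    R.Routes (G.chipAt x.1, x.2) (G.chipAt (R.step^[n] x).1, (R.step^[n] x).2) := by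
  induction n with
  | zero => exact .refl
  | succ n ih =>
    rw [Function.iterate_succ_apply']
    by_cases h : G.IsSink (R.step^[n] x).1
    · rwa [R.step_of_isSink h]
    · exact ih.tail (R.fires_step h)

theorem routesTo_chipAddition {v : G.NonSink} {ρ : G.RotorConfig} (h : R.ReachesSink v ρ) :
    R.RoutesTo (G.chipAt v) ρ (R.chipAddition v ρ) := by
  classical
  have hroutes := R.routes_step_iterate ((v : V), ρ) (Nat.find h)
  rw [G.chipAt_of_isSink (Nat.find_spec h)] at hroutes
  rw [chipAddition, dif_pos h, RoutesTo]
  convert hroutes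

theorem existsUnique_routesTo [Finite V] [Finite E] {s : V} (hs : G.IsGlobalSink s)
    (σ : G.ChipConfig) (ρ : G.RotorConfig) : ∃! ρ', R.RoutesTo σ ρ ρ' := by
  refine existsUnique_of_exists_of_unique ?_ fun _ _ => RoutesTo.unique
  induction σ using G.chipConfig_induction generalizing ρ with
  | zero => exact ⟨ρ, .refl⟩
  | add σ τ hσ hτ =>
    obtain ⟨ρ₁, h₁⟩ := hσ ρ
    obtain ⟨ρ₂, h₂⟩ := hτ ρ₁
    exact ⟨ρ₂, h₁.add h₂⟩
  | chip v => exact ⟨_, R.routesTo_chipAddition (R.reachesSink hs v ρ)⟩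

end CyclicOrdering

end Termination

section Acyclic

variable {G} in
theorem IsGlobalSink.eq_of_isSink {s w : V} (hs : G.IsGlobalSink s) (hw : G.IsSink w) :
    w = s := by
  rcases (hs.2 w).cases_head with h | ⟨c, ⟨e, -, he, -⟩, -⟩
  · exact h
  · exact absurd he (hw e)

theorem adjIn_rotorEdges_iff (ρ : G.RotorConfig) (a b : V) :
    G.AdjIn (G.rotorEdges ρ) a b ↔ ∃ h : ¬ G.IsSink a, G.head (ρ ⟨a, h⟩) = b := by
  constructor
  · rintro ⟨_, ⟨v, rfl⟩, htail, rfl⟩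
    obtain rfl : (v : V) = a := (ρ v).2.symm.trans htail
    exact ⟨v.2, rfl⟩
  · rintro ⟨h, rfl⟩
    exact ⟨_, ⟨⟨a, h⟩, rfl⟩, (ρ ⟨a, h⟩).2, rfl⟩

theorem isAcyclicRotor_of_rank {ρ : G.RotorConfig} (d : V → ℕ)
    (hd : ∀ v : G.NonSink, d (G.head (ρ v)) < d v) : G.IsAcyclicRotor ρ := by
  intro v hv
  have hdecr : Relation.TransGen (fun m n : ℕ => n < m) (d v) (d v) := by
    refine Relation.TransGen.lift d (fun a b hab => ?_) _ _ hv
    obtain ⟨ha, rfl⟩ := (G.adjIn_rotorEdges_iff ρ a b).1 hab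
    exact hd ⟨a, ha⟩
  exact absurd (Relation.transGen_eq_self (r := fun m n : ℕ => n < m) ▸ hdecr) (lt_irrefl _)

theorem exists_isAcyclicRotor {s : V} (hs : G.IsGlobalSink s) :
    ∃ ρ : G.RotorConfig, G.IsAcyclicRotor ρ := by
  obtain ⟨d, hd⟩ := exists_rank_of_reflTransGen hs.2
  have hedge (v : G.NonSink) : ∃ e : {e : E // G.tail e = v}, d (G.head e) < d v := by
    obtain ⟨_, ⟨e, -, he, rfl⟩, hlt⟩ := hd v fun hv => v.2 (hv ▸ hs.1)
    exact ⟨⟨e, he⟩, hlt⟩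
  choose ρ hρ using hedge
  exact ⟨ρ, G.isAcyclicRotor_of_rank d hρ⟩

theorem nonempty_orientedSpanningTree {s : V} (hs : G.IsGlobalSink s) :
    Nonempty G.OrientedSpanningTree :=
  let ⟨ρ, hρ⟩ := G.exists_isAcyclicRotor hs
  ⟨G.treeEquiv ⟨ρ, hρ⟩⟩

end Acyclic

section Unicycle

open Classical in
/-- The map following the rotors in the graph with an additional edge from each sink to `v`. -/
noncomputable def followRotor (v : V) (ρ : G.RotorConfig) (u : V) : V :=
  if h : G.IsSink u then v else G.head (ρ ⟨u, h⟩)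

theorem followRotor_of_isSink {v u : V} (ρ : G.RotorConfig) (h : G.IsSink u) :
    G.followRotor v ρ u = v := dif_pos h

theorem followRotor_coe (v : V) (ρ : G.RotorConfig) (u : G.NonSink) :
    G.followRotor v ρ u = G.head (ρ u) := dif_neg u.2

/-- In the graph with an additional edge from each sink to `v`, the rotors have exactly one cycle,
and the chip is on it: equivalently, every vertex leads to the chip. -/
def IsUnicycle (v : V) (x : V × G.RotorConfig) : Prop :=
  ∀ u, ∃ k, (G.followRotor v x.2)^[k] u = x.1

variable {G}

theorem IsUnicycle.isAcyclicRotor {v s : V} {ρ : G.RotorConfig}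
    (h : G.IsUnicycle v (s, ρ)) (hs : G.IsSink s) : G.IsAcyclicRotor ρ := by
  intro u hu
  obtain ⟨k, hk : (G.followRotor v ρ)^[k] u = s⟩ := h u
  induction k generalizing u with
  | zero =>
    obtain ⟨c, hc, -⟩ := Relation.TransGen.head'_iff.1 hu
    obtain ⟨hns, -⟩ := (G.adjIn_rotorEdges_iff ρ _ _).1 hc
    exact hns (by rwa [show u = s from hk])
  | succ k ih =>
    obtain ⟨c, hc, hcu⟩ := Relation.TransGen.head'_iff.1 hu
    obtain ⟨hns, rfl⟩ := (G.adjIn_rotorEdges_iff ρ _ _).1 hc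
    rw [Function.iterate_succ_apply, G.followRotor_coe v ρ ⟨u, hns⟩] at hk
    exact ih _ (.tail' hcu hc) hk

theorem IsAcyclicRotor.isUnicycle [Finite V] {s : V} {ρ : G.RotorConfig} (h : G.IsAcyclicRotor ρ)
    (hs : G.IsGlobalSink s) (v : V) : G.IsUnicycle v (s, ρ) := by
  let r : V → V → Prop := fun a b => Relation.TransGen (G.AdjIn (G.rotorEdges ρ)) b a
  have : Std.Irrefl r := ⟨h⟩
  have : IsTrans V r := ⟨fun a b c hab hbc => hbc.trans hab⟩
  intro u
  induction u using (Finite.wellFounded_of_trans_of_irrefl r).induction with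
  | h u ih =>
    by_cases hu : G.IsSink u
    · exact ⟨0, hs.eq_of_isSink hu⟩
    · obtain ⟨k, hk⟩ := ih (G.head (ρ ⟨u, hu⟩))
        (.single ((G.adjIn_rotorEdges_iff ρ _ _).2 ⟨hu, rfl⟩))
      refine ⟨k + 1, ?_⟩
      rw [Function.iterate_succ_apply, G.followRotor_coe v ρ ⟨u, hu⟩, hk]

-- A path to the chip only uses the rotors of the vertices before the chip.
theorem IsUnicycle.congr {v w : V} {ρ ρ' : G.RotorConfig} (h : G.IsUnicycle v (w, ρ))
    (heq : ∀ u : G.NonSink, (u : V) ≠ w → ρ' u = ρ u) : G.IsUnicycle v (w, ρ') := by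
  have hfollow {u : V} (hu : u ≠ w) : G.followRotor v ρ' u = G.followRotor v ρ u := by
    by_cases hsink : G.IsSink u
    · simp only [G.followRotor_of_isSink _ hsink]
    · simp only [G.followRotor_coe _ _ ⟨u, hsink⟩, heq ⟨u, hsink⟩ hu]
  intro u
  obtain ⟨k, hk : (G.followRotor v ρ)^[k] u = w⟩ := h u
  induction k generalizing u with
  | zero => exact ⟨0, hk⟩
  | succ k ih =>
    by_cases hu : u = w
    · exact ⟨0, hu⟩
    · obtain ⟨l, hl⟩ := ih _ hk
      refine ⟨l + 1, ?_⟩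
      rwa [Function.iterate_succ_apply, hfollow hu]

namespace CyclicOrdering

variable (R : G.CyclicOrdering)

open Classical in
/-- Advance the rotor at `w`, if `w` is not a sink. -/
noncomputable def advanceAt (ρ : G.RotorConfig) (w : V) : G.RotorConfig :=
  if h : G.IsSink w then ρ else R.advance ρ ⟨w, h⟩

theorem advanceAt_of_ne (ρ : G.RotorConfig) {w : V} {u : G.NonSink} (h : (u : V) ≠ w) :
    R.advanceAt ρ w u = ρ u := by
  unfold advanceAt
  split_ifs
  · rfl
  · exact R.advance_of_ne _ fun hu => h (congrArg Subtype.val hu)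

theorem advanceAt_injective (w : V) : Function.Injective fun ρ => R.advanceAt ρ w := by
  unfold advanceAt
  split_ifs with h
  · exact Function.injective_id
  · exact R.advance_injective ⟨w, h⟩

/-- The rotor-router operation in which a chip at a sink moves to `v` instead of being absorbed. -/
noncomputable def recurrentStep (v : V) (x : V × G.RotorConfig) : V × G.RotorConfig :=
  (G.followRotor v (R.advanceAt x.2 x.1) x.1, R.advanceAt x.2 x.1)

theorem recurrentStep_of_isSink {v : V} {x : V × G.RotorConfig} (h : G.IsSink x.1) :
    R.recurrentStep v x = (v, x.2) := by
  simp [recurrentStep, followRotor, advanceAt, h]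

theorem recurrentStep_of_not_isSink {v : V} {x : V × G.RotorConfig} (h : ¬ G.IsSink x.1) :
    R.recurrentStep v x = R.step x := by
  simp [recurrentStep, followRotor, advanceAt, h, step, advance_self]

theorem isUnicycle_advanceAt {v : V} {x : V × G.RotorConfig} (hx : G.IsUnicycle v x) :
    G.IsUnicycle v (x.1, R.advanceAt x.2 x.1) :=
  IsUnicycle.congr hx fun _ => R.advanceAt_of_ne x.2

theorem mapsTo_recurrentStep (v : V) :
    Set.MapsTo (R.recurrentStep v) {x | G.IsUnicycle v x} {x | G.IsUnicycle v x} := by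
  intro x hx u
  obtain ⟨k, hk⟩ := R.isUnicycle_advanceAt hx u
  exact ⟨k + 1, by rw [Function.iterate_succ_apply']; exact congrArg _ hk⟩

-- The chip comes back from its new position to its old one by following the advanced rotors, so
-- its old position is the only predecessor of the new one on the cycle.
theorem injOn_recurrentStep (v : V) : Set.InjOn (R.recurrentStep v) {x | G.IsUnicycle v x} := by
  intro x hx y hy hxy
  have hρ : R.advanceAt x.2 x.1 = R.advanceAt y.2 y.1 := congrArg Prod.snd hxy
  have hperiodic (z : V × G.RotorConfig) (hz : G.IsUnicycle v z) :
      z.1 ∈ Function.periodicPts (G.followRotor v (R.advanceAt z.2 z.1)) := by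
    obtain ⟨k, hk⟩ := R.isUnicycle_advanceAt hz (G.followRotor v (R.advanceAt z.2 z.1) z.1)
    exact ⟨k + 1, k.succ_pos, hk⟩
  have hchip : x.1 = y.1 := by
    have hx' := hperiodic x hx
    have hnext : G.followRotor v (R.advanceAt x.2 x.1) x.1 =
      G.followRotor v (R.advanceAt y.2 y.1) y.1 := congrArg Prod.fst hxy
    rw [hρ] at hx' hnext
    exact (Function.bijOn_periodicPts _).injOn hx' (hperiodic y hy) hnext
  exact Prod.ext hchip (R.advanceAt_injective y.1 (hchip ▸ hρ))

theorem recurrentStep_iterate {v : V} {ρ : G.RotorConfig} {n : ℕ}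
    (h : ∀ m < n, ¬ G.IsSink (R.step^[m] (v, ρ)).1) :
    (R.recurrentStep v)^[n] (v, ρ) = R.step^[n] (v, ρ) := by
  induction n with
  | zero => rfl
  | succ n ih =>
    rw [Function.iterate_succ_apply', Function.iterate_succ_apply',
      ih fun m hm => h m (Nat.lt_succ_of_lt hm), R.recurrentStep_of_not_isSink (h n n.lt_succ_self)]

theorem exists_firstReturn_chipAddition {s : V} (hs : G.IsGlobalSink s) {v : G.NonSink}
    {ρ : G.RotorConfig} (h : R.ReachesSink v ρ) :
    ∃ n, (R.recurrentStep v)^[n + 1] (s, ρ) = (s, R.chipAddition v ρ) ∧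
      ∀ m < n, (R.recurrentStep v)^[m + 1] (s, ρ) ∉ {x | x.1 = s} := by
  classical
  have hiterate (n : ℕ) (hn : n ≤ Nat.find h) :
      (R.recurrentStep v)^[n + 1] (s, ρ) = R.step^[n] ((v : V), ρ) := by
    rw [Function.iterate_succ_apply, R.recurrentStep_of_isSink hs.1]
    exact R.recurrentStep_iterate fun m hm => Nat.find_min h (hm.trans_le hn)
  refine ⟨Nat.find h, ?_, fun m hm heq => ?_⟩
  · rw [hiterate _ le_rfl, chipAddition, dif_pos h]
    refine Prod.ext (hs.eq_of_isSink (Nat.find_spec h)) ?_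
    convert rfl
  · rw [hiterate m hm.le] at heq
    exact Nat.find_min h hm (by rw [show _ = s from heq]; exact hs.1)

theorem bijOn_chipAddition [Finite V] [Finite E] {s : V} (hs : G.IsGlobalSink s)
    (v : G.NonSink) :
    Set.BijOn (R.chipAddition v) {ρ | G.IsAcyclicRotor ρ} {ρ | G.IsAcyclicRotor ρ} := by
  have hreturn (ρ : G.RotorConfig) :=
    R.exists_firstReturn_chipAddition hs (R.reachesSink hs v ρ)
  have hmaps : Set.MapsTo (R.chipAddition v) {ρ | G.IsAcyclicRotor ρ}
      {ρ | G.IsAcyclicRotor ρ} := by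
    intro ρ hρ
    obtain ⟨n, hn, -⟩ := hreturn ρ
    have hunicycle : G.IsUnicycle v (s, R.chipAddition v ρ) :=
      hn ▸ (R.mapsTo_recurrentStep v).iterate (n + 1) (hρ.isUnicycle hs v)
    exact hunicycle.isAcyclicRotor hs.1
  have hinj : Set.InjOn (R.chipAddition v) {ρ | G.IsAcyclicRotor ρ} := by
    intro ρ hρ ρ' hρ' heq
    obtain ⟨m, hm, hm_first⟩ := hreturn ρ
    obtain ⟨n, hn, hn_first⟩ := hreturn ρ'
    exact congrArg Prod.snd (eq_of_firstReturn_eq (A := {x : V × G.RotorConfig | x.1 = s})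
      (R.mapsTo_recurrentStep v)
      (R.injOn_recurrentStep v) ⟨hρ.isUnicycle hs v, rfl⟩ ⟨hρ'.isUnicycle hs v, rfl⟩
      hm_first hn_first (by rw [hm, hn, heq]))
  exact ((Set.toFinite _).injOn_iff_bijOn_of_mapsTo hmaps).1 hinj

end CyclicOrdering

end Unicycle

section RotorRouterGroup

theorem rotorEdges_injective : Function.Injective G.rotorEdges := by
  intro ρ ρ' h
  refine funext fun v => Subtype.ext ?_
  rw [← G.mem_rotorEdges_iff ρ' v, ← h]
  exact (G.mem_rotorEdges_iff ρ v _).2 rfl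

namespace CyclicOrdering

variable {G} (R : G.CyclicOrdering) [Finite V] [Finite E] {s : V} (hs : G.IsGlobalSink s)

/-- The rotor configuration `σ(ρ)` obtained by routing all chips of `σ` to the sink. -/
noncomputable def routed (σ : G.ChipConfig) (ρ : G.RotorConfig) : G.RotorConfig :=
  (R.existsUnique_routesTo hs σ ρ).choose

theorem routesTo_iff_routed_eq {σ : G.ChipConfig} {ρ ρ' : G.RotorConfig} :
    R.RoutesTo σ ρ ρ' ↔ R.routed hs σ ρ = ρ' := by
  have hrouted : R.RoutesTo σ ρ (R.routed hs σ ρ) :=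
    (R.existsUnique_routesTo hs σ ρ).choose_spec.1
  exact ⟨hrouted.unique, fun h => h ▸ hrouted⟩

theorem routesTo_routed (σ : G.ChipConfig) (ρ : G.RotorConfig) :
    R.RoutesTo σ ρ (R.routed hs σ ρ) := (R.routesTo_iff_routed_eq hs).2 rfl

theorem routed_zero (ρ : G.RotorConfig) : R.routed hs 0 ρ = ρ :=
  (R.routesTo_iff_routed_eq hs).1 .refl

theorem routed_add (σ τ : G.ChipConfig) (ρ : G.RotorConfig) :
    R.routed hs (σ + τ) ρ = R.routed hs τ (R.routed hs σ ρ) :=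
  (R.routesTo_iff_routed_eq hs).1 ((R.routesTo_routed hs σ ρ).add (R.routesTo_routed hs τ _))

theorem routed_chipAt (v : G.NonSink) (ρ : G.RotorConfig) :
    R.routed hs (G.chipAt v) ρ = R.chipAddition v ρ :=
  (R.routesTo_iff_routed_eq hs).1 (R.routesTo_chipAddition (R.reachesSink hs v ρ))

theorem routed_eq_of_routes {σ τ : G.ChipConfig} {ρ ρ' : G.RotorConfig}
    (h : R.Routes (σ, ρ) (τ, ρ')) : R.routed hs σ ρ = R.routed hs τ ρ' :=
  (R.routesTo_iff_routed_eq hs).1 (h.trans (R.routesTo_routed hs τ ρ'))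

theorem bijOn_routed (σ : G.ChipConfig) :
    Set.BijOn (R.routed hs σ) {ρ | G.IsAcyclicRotor ρ} {ρ | G.IsAcyclicRotor ρ} := by
  induction σ using G.chipConfig_induction with
  | zero => exact (Set.bijOn_id _).congr fun ρ _ => (R.routed_zero hs ρ).symm
  | add σ τ hσ hτ => exact (hτ.comp hσ).congr fun ρ _ => (R.routed_add hs σ τ ρ).symm
  | chip v =>
    exact (R.bijOn_chipAddition hs v).congr fun ρ _ => (R.routed_chipAt hs v ρ).symm

/-- The action `ρ ↦ σ(ρ)` of chip configurations on the acyclic rotor configurations. -/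
noncomputable def acyclicRotorAction :
    Multiplicative G.ChipConfig →* Equiv.Perm {ρ : G.RotorConfig // G.IsAcyclicRotor ρ} where
  toFun σ := (R.bijOn_routed hs σ.toAdd).equiv
  map_one' := Equiv.ext fun ρ => Subtype.ext (R.routed_zero hs ρ)
  map_mul' σ τ := Equiv.ext fun ρ => Subtype.ext <| by
    rw [mul_comm]
    exact R.routed_add hs τ.toAdd σ.toAdd ρ

/-- The action of chip configurations on the oriented spanning trees. -/
noncomputable def treeAction :
    Multiplicative G.ChipConfig →* Equiv.Perm G.OrientedSpanningTree :=
  G.treeEquiv.permCongrHom.toMonoidHom.comp (R.acyclicRotorAction hs)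

theorem coe_treeAction_treeEquiv (σ : G.ChipConfig)
    (ρ : {ρ : G.RotorConfig // G.IsAcyclicRotor ρ}) :
    (R.treeAction hs (.ofAdd σ) (G.treeEquiv ρ) : Set E) = G.rotorEdges (R.routed hs σ ρ) := by
  change (G.treeEquiv (R.acyclicRotorAction hs (.ofAdd σ) (G.treeEquiv.symm (G.treeEquiv ρ))) :
    Set E) = _
  rw [Equiv.symm_apply_apply]
  rfl

theorem treeAction_apply_eq_iff {σ κ : G.ChipConfig}
    {ρ ρ' : {ρ : G.RotorConfig // G.IsAcyclicRotor ρ}} :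
    R.treeAction hs (.ofAdd σ) (G.treeEquiv ρ) = R.treeAction hs (.ofAdd κ) (G.treeEquiv ρ') ↔
      R.routed hs σ ρ = R.routed hs κ ρ' := by
  rw [Subtype.ext_iff, coe_treeAction_treeEquiv, coe_treeAction_treeEquiv,
    G.rotorEdges_injective.eq_iff]

theorem routesTo_iff_treeAction_eq {σ : G.ChipConfig}
    {ρ : {ρ : G.RotorConfig // G.IsAcyclicRotor ρ}} {ρ' : G.RotorConfig} :
    R.RoutesTo σ ρ ρ' ↔
      (R.treeAction hs (.ofAdd σ) (G.treeEquiv ρ) : Set E) = G.rotorEdges ρ' := by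
  rw [coe_treeAction_treeEquiv, G.rotorEdges_injective.eq_iff, routesTo_iff_routed_eq]

theorem isChipAdditionPerm_iff {v : G.NonSink} {π : Equiv.Perm G.OrientedSpanningTree} :
    R.IsChipAdditionPerm v π ↔ π = R.treeAction hs (.ofAdd (G.chipAt v)) := by
  have hcoe (ρ : {ρ : G.RotorConfig // G.IsAcyclicRotor ρ}) :
      (R.treeAction hs (.ofAdd (G.chipAt v)) (G.treeEquiv ρ) : Set E) =
        G.rotorEdges (R.chipAddition v ρ) := by
    rw [coe_treeAction_treeEquiv, routed_chipAt]
  refine Iff.trans ?_ Equiv.ext_iff.symm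
  rw [← G.treeEquiv.forall_congr_right]
  exact forall_congr' fun ρ => by rw [← hcoe ρ, ← Subtype.ext_iff]

theorem chipClass_eq_of_treeAction_apply_eq {σ κ : G.ChipConfig} {T : G.OrientedSpanningTree}
    (h : R.treeAction hs (.ofAdd σ) T = R.treeAction hs (.ofAdd κ) T) :
    G.chipClass σ = G.chipClass κ := by
  obtain ⟨ρ, rfl⟩ := G.treeEquiv.surjective T
  rw [treeAction_apply_eq_iff] at h
  exact R.chipClass_eq_of_routesTo (R.routesTo_routed hs σ ρ) (h ▸ R.routesTo_routed hs κ ρ)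

theorem treeAction_fullTurns [Fintype G.NonSink] (a : G.ChipConfig) :
    R.treeAction hs (.ofAdd (G.fullTurns a)) = R.treeAction hs (.ofAdd (G.fullTurnOutput a)) := by
  refine Equiv.ext fun T => ?_
  obtain ⟨ρ, rfl⟩ := G.treeEquiv.surjective T
  exact (R.treeAction_apply_eq_iff hs).2 (R.routed_eq_of_routes hs (R.routes_fullTurns a ρ))

theorem treeAction_eq_iff {σ κ : G.ChipConfig} :
    R.treeAction hs (.ofAdd σ) = R.treeAction hs (.ofAdd κ) ↔
      G.chipClass σ = G.chipClass κ := by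
  constructor
  · intro h
    obtain ⟨T⟩ := G.nonempty_orientedSpanningTree hs
    exact R.chipClass_eq_of_treeAction_apply_eq hs (T := T) (by rw [h])
  · intro h
    have := Fintype.ofFinite G.NonSink
    obtain ⟨a, b, hab⟩ := G.chipClass_eq_iff.1 h
    have hperm := congrArg (fun σ => R.treeAction hs (.ofAdd σ)) hab
    simp only [ofAdd_add, map_mul, treeAction_fullTurns, mul_assoc] at hperm
    rw [← map_mul (R.treeAction hs) (.ofAdd (G.fullTurnOutput b)), mul_comm, map_mul] at hperm
    exact mul_right_cancel hperm

include R hs in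
-- Negatives exist in the image because permutations of a finite set have finite order.
theorem chipClass_surjective : Function.Surjective G.chipClass := by
  intro g
  obtain ⟨σ, κ, hσ⟩ := G.exists_chipClass_eq_add g
  obtain ⟨n, hn, hperm⟩ := (isOfFinOrder_of_finite (R.treeAction hs (.ofAdd κ))).exists_pow_eq_one
  have hκ : G.chipClass (n • κ) = 0 := by
    rw [← map_zero G.chipClassHom, chipClassHom_apply, ← R.treeAction_eq_iff hs, ofAdd_nsmul,
      map_pow, hperm, ofAdd_zero, map_one]
  obtain ⟨m, rfl⟩ := Nat.exists_eq_succ_of_ne_zero hn.ne'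
  refine ⟨σ + m • κ, ?_⟩
  rw [chipClass_add, hσ, add_assoc, add_comm (G.chipClass κ), ← chipClass_add, ← succ_nsmul, hκ,
    add_zero]

theorem mrange_treeAction :
    MonoidHom.mrange (R.treeAction hs) = R.rotorRouterGroup.toSubmonoid := by
  rw [rotorRouterGroup, Subgroup.closure_toSubmonoid_of_finite]
  apply le_antisymm
  · rintro _ ⟨σ, rfl⟩
    obtain ⟨σ, rfl⟩ := Multiplicative.ofAdd.surjective σ
    induction σ using G.chipConfig_induction with
    | zero => rw [ofAdd_zero, map_one]; exact one_mem _
    | add σ τ hσ hτ => rw [ofAdd_add, map_mul]; exact mul_mem hσ hτ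
    | chip v => exact Submonoid.subset_closure ⟨v, (R.isChipAdditionPerm_iff hs).2 rfl⟩
  · refine Submonoid.closure_le.2 ?_
    rintro π ⟨v, hπ⟩
    exact ⟨_, ((R.isChipAdditionPerm_iff hs).1 hπ).symm⟩

/-- The action of chip configurations as a homomorphism to the rotor-router group. -/
noncomputable def rotorRouterHom : Multiplicative G.ChipConfig →* R.rotorRouterGroup :=
  (R.treeAction hs).codRestrict R.rotorRouterGroup fun σ =>
    (R.mrange_treeAction hs).le ⟨σ, rfl⟩

theorem rotorRouterHom_surjective : Function.Surjective (R.rotorRouterHom hs) := by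
  rintro ⟨π, hπ⟩
  obtain ⟨σ, rfl⟩ := (R.mrange_treeAction hs).ge hπ
  exact ⟨σ, rfl⟩

theorem rotorRouterHom_eq_iff {σ κ : G.ChipConfig} :
    R.rotorRouterHom hs (.ofAdd σ) = R.rotorRouterHom hs (.ofAdd κ) ↔
      G.chipClass σ = G.chipClass κ :=
  Subtype.ext_iff.trans (R.treeAction_eq_iff hs)

/-- The isomorphism from the sandpile group to the rotor-router group induced by `σ ↦ σ(ρ)`. -/
noncomputable def sandpileEquiv : Multiplicative G.SandpileGroup ≃* R.rotorRouterGroup :=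
  mulEquivOfSurjective G.chipClassHom.toMultiplicative (R.rotorRouterHom hs)
    (R.chipClass_surjective hs) (R.rotorRouterHom_surjective hs) fun _ _ =>
      (R.rotorRouterHom_eq_iff hs).symm

theorem coe_sandpileEquiv_chipClass (σ : G.ChipConfig) :
    (R.sandpileEquiv hs (.ofAdd (G.chipClass σ)) : Equiv.Perm G.OrientedSpanningTree) =
      R.treeAction hs (.ofAdd σ) :=
  congrArg Subtype.val (mulEquivOfSurjective_apply G.chipClassHom.toMultiplicative
    (R.rotorRouterHom hs) _ _ _ (.ofAdd σ))

-- Turning the rotors `ρ` into `ρ'` by brute force emits the chips `β`. The chips used for this,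
-- less `β`, then take `ρ` to `ρ'`.
theorem exists_treeAction_apply_eq (T T' : G.OrientedSpanningTree) :
    ∃ σ : G.ChipConfig, R.treeAction hs (.ofAdd σ) T = T' := by
  have := Fintype.ofFinite G.NonSink
  obtain ⟨ρ, rfl⟩ := G.treeEquiv.surjective T
  obtain ⟨ρ', rfl⟩ := G.treeEquiv.surjective T'
  obtain ⟨n, hn⟩ := R.exists_rotate_eq ρ.1 ρ'.1
  let β := R.emitted n ρ.1
  have hroutes : R.Routes (n, ρ.1) (β, ρ'.1) := by
    simpa only [add_zero, zero_add, hn] using R.routes_rotate n 0 ρ.1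
  have hβ : R.treeAction hs (.ofAdd n) (G.treeEquiv ρ) =
      R.treeAction hs (.ofAdd β) (G.treeEquiv ρ') :=
    (R.treeAction_apply_eq_iff hs).2 (R.routed_eq_of_routes hs hroutes)
  obtain ⟨σ, hσ⟩ := R.chipClass_surjective hs (G.chipClass n - G.chipClass β)
  have hdiff : R.treeAction hs (.ofAdd (β + σ)) = R.treeAction hs (.ofAdd n) :=
    (R.treeAction_eq_iff hs).2 (by rw [chipClass_add, hσ, add_sub_cancel])
  refine ⟨σ, (R.treeAction hs (.ofAdd β)).injective ?_⟩
  rw [← hβ, ← hdiff, ofAdd_add, map_mul, Equiv.Perm.mul_apply]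

theorem eq_one_of_sandpileEquiv_apply_eq_self {g : Multiplicative G.SandpileGroup}
    {T : G.OrientedSpanningTree}
    (h : (R.sandpileEquiv hs g : Equiv.Perm G.OrientedSpanningTree) T = T) : g = 1 := by
  obtain ⟨σ, hσ⟩ := R.chipClass_surjective hs g.toAdd
  obtain rfl : .ofAdd (G.chipClass σ) = g := congrArg Multiplicative.ofAdd hσ
  rw [coe_sandpileEquiv_chipClass] at h
  have hzero : G.chipClass σ = G.chipClass 0 :=
    R.chipClass_eq_of_treeAction_apply_eq hs (T := T) (by rw [h, ofAdd_zero, map_one]; rfl)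
  rw [hzero, ← chipClassHom_apply, map_zero, ofAdd_zero]

end CyclicOrdering

end RotorRouterGroup

end MultiDigraph

theorem mainTheorem3 {V : Type*} {E : Type*} [Finite V] [Finite E]
    (G : MultiDigraph V E) (s : V) (hs : G.IsGlobalSink s) (R : G.CyclicOrdering) :
    -- every chip reaches the sink, and `σ(ρ)` does not depend on the order of the routings
    (∀ v ρ, R.ReachesSink v ρ) ∧
    (∀ σ ρ, ∃! ρ', R.RoutesTo σ ρ ρ') ∧
    -- each `E_v` permutes the (nonempty) set of acyclic rotor configurations
    (∀ v, Set.BijOn (R.chipAddition v) {ρ | G.IsAcyclicRotor ρ} {ρ | G.IsAcyclicRotor ρ}) ∧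
    Nonempty G.OrientedSpanningTree ∧
    -- the sandpile group is isomorphic to the rotor-router group, through the action `σ(ρ)`
    ∃ Φ : Multiplicative G.SandpileGroup ≃* R.rotorRouterGroup,
      (∀ v, R.IsChipAdditionPerm v (Φ (Multiplicative.ofAdd (G.chipClass (G.singleChip v))))) ∧
      (∀ (σ : G.ChipConfig) (ρ : {ρ : G.RotorConfig // G.IsAcyclicRotor ρ}) (ρ' : G.RotorConfig),
        R.RoutesTo σ ρ ρ' ↔
          ((Φ (Multiplicative.ofAdd (G.chipClass σ)) : Equiv.Perm G.OrientedSpanningTree)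
            (G.treeEquiv ρ) : Set E) = G.rotorEdges ρ') ∧
      -- this action is transitive
      (∀ T T' : G.OrientedSpanningTree, ∃ σ : G.ChipConfig,
        (Φ (Multiplicative.ofAdd (G.chipClass σ)) : Equiv.Perm G.OrientedSpanningTree) T = T') ∧
      -- this action is free
      (∀ (g : Multiplicative G.SandpileGroup) (T : G.OrientedSpanningTree),
        (Φ g : Equiv.Perm G.OrientedSpanningTree) T = T → g = 1) := by
  refine ⟨R.reachesSink hs, R.existsUnique_routesTo hs, R.bijOn_chipAddition hs,
    G.nonempty_orientedSpanningTree hs, R.sandpileEquiv hs, fun v => ?_, fun σ ρ ρ' => ?_,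
    fun T T' => ?_, fun g T => R.eq_one_of_sandpileEquiv_apply_eq_self hs⟩
  · rw [R.isChipAdditionPerm_iff hs, R.coe_sandpileEquiv_chipClass hs, G.chipAt_coe]
  · rw [R.coe_sandpileEquiv_chipClass hs]
    exact R.routesTo_iff_treeAction_eq hs
  · simpa only [R.coe_sandpileEquiv_chipClass hs] using R.exists_treeAction_apply_eq hs T T'
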